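/- Let $\widehat{\mathrm G}_0^1$ be the group, under composition, of formal diffeomorphisms of $(\mathbb C,0)$, i.e. of formal power series $\widehat f\in\mathbb C[[x]]$ with $\widehat f(0)=0$ and $\widehat f'(0)\neq 0$, and let $\mathrm G_0^1=\mathrm{Diff}(\mathbb C,0)$ be the group, under composition, of germs at $0$ of holomorphic maps $f$ with $f(0)=0$ and $f'(0)\neq 0$. Then there is no faithful representation, i.e. no injective group homomorphism, of the group $$\mathcal G=\langle a,\,b\mid b^2ab^{-2}=a^2\rangle$$ into $\widehat{\mathrm G}_0^1$, and there is none into $\mathrm G_0^1$. -/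

import Mathlib

open Filter Topology

noncomputable section

/-! ### Formal diffeomorphisms of the line at the origin -/

/-- A formal diffeomorphism of `ℂ` at `0`: a formal power series with zero constant term and
invertible linear part. -/
@[ext]
structure FormalDiff where
  series : PowerSeries ℂ
  constantCoeff_eq : PowerSeries.constantCoeff series = 0
  coeff_one_ne : PowerSeries.coeff 1 series ≠ 0

namespace FormalDiff

theorem hasSubst (f : FormalDiff) : PowerSeries.HasSubst f.series :=
  PowerSeries.HasSubst.of_constantCoeff_zero' f.constantCoeff_eq

theorem coeff_one_subst (f g : FormalDiff) :
    PowerSeries.coeff 1 (PowerSeries.subst g.series f.series) =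
      PowerSeries.coeff 1 f.series * PowerSeries.coeff 1 g.series := by
  rw [PowerSeries.coeff_subst' g.hasSubst, finsum_eq_single _ 1]
  · simp
  · intro n hn
    rcases n with _ | _ | n
    · simp [f.constantCoeff_eq]
    · exact absurd rfl hn
    · have h : PowerSeries.X ^ (n + 2) ∣ g.series ^ (n + 2) :=
        pow_dvd_pow_of_dvd (PowerSeries.X_dvd_iff.mpr g.constantCoeff_eq) _
      rw [PowerSeries.X_pow_dvd_iff] at h
      rw [h 1 (by omega), smul_zero]

/-- The composite `f ∘ g`: the series `f(g(x))`. -/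
def comp (f g : FormalDiff) : FormalDiff where
  series := PowerSeries.subst g.series f.series
  constantCoeff_eq :=
    PowerSeries.constantCoeff_subst_eq_zero g.constantCoeff_eq _ f.constantCoeff_eq
  coeff_one_ne := by
    rw [coeff_one_subst]
    exact mul_ne_zero f.coeff_one_ne g.coeff_one_ne

/-- The identity, that is the series `x`. -/
def id : FormalDiff where
  series := PowerSeries.X
  constantCoeff_eq := by simp
  coeff_one_ne := by simp

/-- The compositional inverse. -/
def inverse (f : FormalDiff) : FormalDiff where
  series := PowerSeries.substInvOfIsUnit f.series (isUnit_iff_ne_zero.mpr f.coeff_one_ne)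
  constantCoeff_eq := PowerSeries.constantCoeff_substInvOfIsUnit _ _
  coeff_one_ne := by
    rw [PowerSeries.coeff_one_substInvOfIsUnit]
    exact Units.ne_zero _

instance : Mul FormalDiff := ⟨comp⟩
instance : One FormalDiff := ⟨id⟩
instance : Inv FormalDiff := ⟨inverse⟩

/-- The group of formal diffeomorphisms of `(ℂ, 0)` under composition. -/
instance : Group FormalDiff :=
  Group.ofLeftAxioms
    (fun f g h => FormalDiff.ext
      (PowerSeries.subst_comp_subst_apply g.hasSubst h.hasSubst f.series))
    (fun f => FormalDiff.ext (PowerSeries.subst_X f.hasSubst))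
    (fun f => FormalDiff.ext
      (PowerSeries.subst_substInvOfIsUnit_left f.series f.constantCoeff_eq
        (isUnit_iff_ne_zero.mpr f.coeff_one_ne)))

end FormalDiff

/-! ### Germs of holomorphic diffeomorphisms of the line at the origin -/

/-- A function on `ℂ` that represents a germ of holomorphic diffeomorphism of `(ℂ, 0)`: it is
holomorphic near `0`, fixes `0`, and has invertible derivative there. -/
structure DiffRep where
  toFun : ℂ → ℂ
  analyticAt : AnalyticAt ℂ toFun 0
  map_zero : toFun 0 = 0
  deriv_ne : deriv toFun 0 ≠ 0

namespace DiffRep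

theorem tendsto (f : DiffRep) : Tendsto f.toFun (𝓝 0) (𝓝 0) := by
  have h := f.analyticAt.continuousAt.tendsto
  rwa [f.map_zero] at h

/-- The composite `f ∘ g`. -/
def comp (f g : DiffRep) : DiffRep where
  toFun := f.toFun ∘ g.toFun
  analyticAt := f.analyticAt.comp_of_eq g.analyticAt g.map_zero
  map_zero := by simp [f.map_zero, g.map_zero]
  deriv_ne := by
    rw [deriv_comp 0 (by rw [g.map_zero]; exact f.analyticAt.differentiableAt)
      g.analyticAt.differentiableAt, g.map_zero]
    exact mul_ne_zero f.deriv_ne g.deriv_ne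

/-- The identity. -/
def id : DiffRep where
  toFun := fun x => x
  analyticAt := analyticAt_id
  map_zero := rfl
  deriv_ne := by simp

/-- A local inverse, given by the inverse function theorem. -/
def inverse (f : DiffRep) : DiffRep where
  toFun := f.analyticAt.hasStrictDerivAt.localInverse _ _ _ f.deriv_ne
  analyticAt := by
    have h := f.analyticAt.analyticAt_localInverse f.deriv_ne
    rwa [f.map_zero] at h
  map_zero := by
    have h : f.analyticAt.hasStrictDerivAt.localInverse _ _ _ f.deriv_ne (f.toFun 0) = 0 :=
      HasStrictFDerivAt.localInverse_apply_image ..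
    rwa [f.map_zero] at h
  deriv_ne := by
    have h := (f.analyticAt.hasStrictDerivAt.to_localInverse f.deriv_ne).hasDerivAt.deriv
    rw [f.map_zero] at h
    rw [h]
    exact inv_ne_zero f.deriv_ne

theorem inverse_comp (f : DiffRep) :
    (comp (inverse f) f).toFun =ᶠ[𝓝 0] DiffRep.id.toFun :=
  HasStrictFDerivAt.eventually_left_inverse
    (f.analyticAt.hasStrictDerivAt.hasStrictFDerivAt_equiv f.deriv_ne)

/-- Two functions define the same germ if they agree near `0`. -/
instance instSetoid : Setoid DiffRep where
  r f g := f.toFun =ᶠ[𝓝 0] g.toFun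
  iseqv := ⟨fun _ => EventuallyEq.rfl, fun h => h.symm, fun h h' => h.trans h'⟩

theorem comp_congr {f f' g g' : DiffRep} (hf : f ≈ f') (hg : g ≈ g') :
    comp f g ≈ comp f' g' := by
  have h1 : f.toFun ∘ g.toFun =ᶠ[𝓝 0] f'.toFun ∘ g.toFun :=
    EventuallyEq.comp_tendsto hf g.tendsto
  have h2 : f'.toFun ∘ g.toFun =ᶠ[𝓝 0] f'.toFun ∘ g'.toFun :=
    EventuallyEq.fun_comp hg f'.toFun
  exact h1.trans h2

end DiffRep

/-- Germs at `0` of holomorphic diffeomorphisms of `(ℂ, 0)`. -/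
def HoloDiff : Type := Quotient DiffRep.instSetoid

namespace HoloDiff

/-- The germ of a representative. -/
def mk (f : DiffRep) : HoloDiff := Quotient.mk _ f

/-- Composition of germs. -/
def comp : HoloDiff → HoloDiff → HoloDiff :=
  Quotient.map₂ DiffRep.comp fun _ _ hf _ _ hg => DiffRep.comp_congr hf hg

theorem exists_left_inv (φ : HoloDiff) : ∃ ψ : HoloDiff, comp ψ φ = mk DiffRep.id := by
  induction φ using Quotient.inductionOn with
  | h f => exact ⟨mk f.inverse, Quotient.sound f.inverse_comp⟩

instance : Mul HoloDiff := ⟨comp⟩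
instance : One HoloDiff := ⟨mk DiffRep.id⟩
/-- Inverse of a germ. It is characterised by `φ⁻¹ * φ = 1`. -/
instance : Inv HoloDiff := ⟨fun φ => Classical.choose (exists_left_inv φ)⟩

/-- The group of germs of holomorphic diffeomorphisms of `(ℂ, 0)` under composition. -/
instance : Group HoloDiff :=
  Group.ofLeftAxioms
    (fun φ ψ χ => by
      induction φ using Quotient.inductionOn with
      | h f => induction ψ using Quotient.inductionOn with
        | h g => induction χ using Quotient.inductionOn with
          | h k => rfl)
    (fun φ => by
      induction φ using Quotient.inductionOn with
      | h f => rfl)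
    (fun φ => Classical.choose_spec (exists_left_inv φ))

end HoloDiff

/-! ### The group `⟨a, b ∣ b² a b⁻² = a²⟩` -/

/-- The relator `b² a b⁻² (a²)⁻¹`, where `a` and `b` are the free generators with index `0`
and `1`. -/
def drutuSapirRelator : FreeGroup (Fin 2) :=
  FreeGroup.of 1 ^ 2 * FreeGroup.of 0 * (FreeGroup.of 1 ^ 2)⁻¹ * (FreeGroup.of 0 ^ 2)⁻¹

/-- The group `⟨a, b ∣ b² a b⁻² = a²⟩`. -/
abbrev DrutuSapirGroup : Type := PresentedGroup ({drutuSapirRelator} : Set (FreeGroup (Fin 2)))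

end

/-! In either group of diffeomorphisms the relation `g² f g⁻² = f²` forces `f` to commute with `h =
g f g⁻¹` (`FormalDiff.mul_conj_eq_conj_mul`), whereas `a` and `b a b⁻¹` do not commute in the
abstract group, as a quotient inside `S₅` shows.

The formal case compares leading terms. The relation makes `f` tangent to the identity; if `f = x +
α x^(k+1) + ⋯` with `α ≠ 0`, conjugation by `g²` scales `α` by `ν^k`, with `ν` the inverse
multiplier of `g²`, while squaring doubles it, so `ν^k = 2`. Suppose `c = [f, h] ≠ 1` has leading
term `γ x^(m+1)`. Then `m > 2k`, and `g² c g⁻² = [f², h²]` is a product of four conjugates of `c` by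
series tangent to the identity, so `ν^m = 4 = ν^(2k)`. Hence `ν` is a root of unity, against `ν^k =
2`.

Germs reduce to this case because the Taylor series is an injective homomorphism. -/

noncomputable section

/-! ### Taylor expansion under substitution -/

namespace PowerSeries

theorem X_pow_dvd_trunc_sub (S : PowerSeries ℂ) (n : ℕ) :
    X ^ n ∣ (S.trunc n : PowerSeries ℂ) - S := by
  rw [X_pow_dvd_iff]
  intro i hi
  rw [map_sub, Polynomial.coeff_coe, coeff_trunc, if_pos hi, sub_self]

/-- First order Taylor expansion: `G(X + h) ≡ G + h G'` modulo the square of the order of `h`. -/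
theorem X_pow_dvd_subst_X_add_sub {h : PowerSeries ℂ} {m : ℕ} (hh : X ^ (m + 1) ∣ h)
    (G : PowerSeries ℂ) :
    X ^ (2 * m + 2) ∣ subst (X + h) G - G - h * derivative ℂ G := by
  obtain ⟨u, rfl⟩ := hh
  have hX : (X : PowerSeries ℂ) ∣ X + X ^ (m + 1) * u := ⟨1 + X ^ m * u, by ring⟩
  have hs : HasSubst (X + X ^ (m + 1) * u : PowerSeries ℂ) :=
    HasSubst.of_constantCoeff_zero' (X_dvd_iff.mp hX)
  -- Truncation reduces to the binomial expansion of a polynomial; the tail contributes only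
  -- multiples of `X ^ (2 * m + 2)`.
  obtain ⟨r, hr⟩ : ∃ r, G = (trunc (2 * m + 2) G : PowerSeries ℂ) + X ^ (2 * m + 2) * r := by
    obtain ⟨r, hr⟩ := X_pow_dvd_trunc_sub G (2 * m + 2)
    exact ⟨-r, by linear_combination -hr⟩
  generalize trunc (2 * m + 2) G = P at hr
  obtain ⟨k, hk⟩ := Polynomial.binomExpansion (P.map (algebraMap ℂ (PowerSeries ℂ)))
    X (X ^ (m + 1) * u)
  have hXP (Q : Polynomial ℂ) : Polynomial.aeval (X : PowerSeries ℂ) Q = Q := by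
    rw [← subst_coe HasSubst.X', X_subst]
  rw [Polynomial.derivative_map, Polynomial.eval_map_algebraMap, Polynomial.eval_map_algebraMap,
    Polynomial.eval_map_algebraMap, ← subst_coe hs, hXP, hXP] at hk
  have hd : derivative ℂ G = (Polynomial.derivative P : PowerSeries ℂ) +
      ((2 * (m : PowerSeries ℂ) + 2) * X ^ (2 * m + 1) * r +
        X ^ (2 * m + 2) * derivative ℂ r) := by
    rw [hr]
    simp [Derivation.leibniz, Derivation.leibniz_pow, derivative_coe]
    ring
  have hG : subst (X + X ^ (m + 1) * u : PowerSeries ℂ) G =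
      subst (X + X ^ (m + 1) * u : PowerSeries ℂ) (P : PowerSeries ℂ) +
        (X + X ^ (m + 1) * u) ^ (2 * m + 2) * subst (X + X ^ (m + 1) * u : PowerSeries ℂ) r := by
    nth_rw 1 [hr]
    rw [subst_add hs, subst_mul hs, subst_pow hs, subst_X hs]
  have hw : (X + X ^ (m + 1) * u : PowerSeries ℂ) ^ (2 * m + 2) =
      X ^ (2 * m + 2) * (1 + X ^ m * u) ^ (2 * m + 2) := by
    rw [← mul_pow]; ring
  rw [hG, hd, hw]
  refine ⟨k * u ^ 2 + (1 + X ^ m * u) ^ (2 * m + 2) *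
    subst (X + X ^ (m + 1) * u : PowerSeries ℂ) r - r -
    ((2 * (m : PowerSeries ℂ) + 2) * X ^ m * u * r + X ^ (m + 1) * u * derivative ℂ r), ?_⟩
  linear_combination hk - hr

theorem constantCoeff_subst_eq {a : PowerSeries ℂ} (ha : constantCoeff a = 0)
    (f : PowerSeries ℂ) : constantCoeff (subst a f : PowerSeries ℂ) = constantCoeff f := by
  have h := constantCoeff_subst_eq_zero ha (f - C (constantCoeff f)) (by simp)
  rw [subst_sub (HasSubst.of_constantCoeff_zero' ha), subst_C, map_sub] at h
  exact (sub_eq_zero.mp h).trans (MvPowerSeries.constantCoeff_C _)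

end PowerSeries

/-! ### Leading terms of series tangent to the identity -/

namespace FormalDiff
open PowerSeries

theorem one_series : (1 : FormalDiff).series = X := rfl

theorem mul_series (f g : FormalDiff) : (f * g).series = subst g.series f.series := rfl

/-- The linear part as a homomorphism. -/
def multiplier : FormalDiff →* ℂ where
  toFun f := coeff 1 f.series
  map_one' := by simp [one_series]
  map_mul' f g := coeff_one_subst f g

theorem multiplier_ne_zero (f : FormalDiff) : multiplier f ≠ 0 := f.coeff_one_ne

/-- `f = x + c x ^ (m + 1) + ⋯`. -/
def IsTangent (m : ℕ) (c : ℂ) (f : FormalDiff) : Prop :=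
  ∃ u : PowerSeries ℂ, constantCoeff u = c ∧ f.series = X + X ^ (m + 1) * u

theorem exists_eq_X_mul (f : FormalDiff) :
    ∃ v, f.series = X * v ∧ constantCoeff v = multiplier f := by
  obtain ⟨v, hv⟩ := X_dvd_iff.mpr f.constantCoeff_eq
  refine ⟨v, hv, ?_⟩
  have : multiplier f = coeff 1 (X * v) := by rw [← hv]; rfl
  rw [this, ← zero_add 1, coeff_succ_X_mul, coeff_zero_eq_constantCoeff_apply]

theorem IsTangent.unique {m : ℕ} {c d : ℂ} {f : FormalDiff} (hc : IsTangent m c f)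
    (hd : IsTangent m d f) : c = d := by
  obtain ⟨u, rfl, hu⟩ := hc
  obtain ⟨v, rfl, hv⟩ := hd
  have h : X ^ (m + 1) * u = X ^ (m + 1) * v := add_left_cancel (hu.symm.trans hv)
  rw [mul_left_cancel₀ (pow_ne_zero _ X_ne_zero) h]

theorem exists_isTangent {f : FormalDiff} (hf : multiplier f = 1) (h1 : f ≠ 1) :
    ∃ m c, m ≠ 0 ∧ c ≠ 0 ∧ IsTangent m c f := by
  have h0 : f.series - X ≠ 0 := fun h => h1 (FormalDiff.ext (sub_eq_zero.mp h))
  obtain ⟨n, hn⟩ := ENat.ne_top_iff_exists.mp (mt order_eq_top.mp h0)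
  obtain ⟨u, hu⟩ : X ^ n ∣ f.series - X := X_pow_dvd_iff.mpr fun i hi =>
    coeff_of_lt_order i (by rw [← hn]; exact_mod_cast hi)
  have hc : coeff n (f.series - X) ≠ 0 := by
    exact (order_eq_nat.mp hn.symm).1
  have hcu : coeff n (f.series - X) = constantCoeff u := by
    rw [hu]; simpa using coeff_X_pow_mul u n 0
  have hf' : coeff 1 f.series = 1 := hf
  rcases n with _ | _ | m
  · simp [f.constantCoeff_eq] at hc
  · simp [hf'] at hc
  · exact ⟨m + 1, constantCoeff u, by omega, hcu ▸ hc, u, rfl, by rw [← hu]; ring⟩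

theorem IsTangent.multiplier_eq {m : ℕ} {c : ℂ} {f : FormalDiff} (hf : IsTangent m c f)
    (hm : m ≠ 0) : multiplier f = 1 := by
  obtain ⟨u, -, hu⟩ := hf
  change coeff 1 f.series = 1
  obtain ⟨m, rfl⟩ := Nat.exists_eq_succ_of_ne_zero hm
  rw [hu, map_add, coeff_one_X, coeff_X_pow_mul', if_neg (by omega), add_zero]

/-- Postcomposition `x + c x ^ (m + 1) + ⋯` with an arbitrary series. -/
theorem IsTangent.exists_subst_eq {m : ℕ} {c : ℂ} {f : FormalDiff} (hf : IsTangent m c f)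
    (G : PowerSeries ℂ) :
    ∃ s, constantCoeff s = coeff 1 G * c ∧ subst f.series G = G + X ^ (m + 1) * s := by
  obtain ⟨u, rfl, hu⟩ := hf
  obtain ⟨r, hr⟩ := X_pow_dvd_subst_X_add_sub (Dvd.intro u rfl : X ^ (m + 1) ∣ _) G
  refine ⟨u * derivative ℂ G + X ^ (m + 1) * r, ?_, ?_⟩
  · have : constantCoeff (derivative ℂ G) = coeff 1 G := by
      rw [← coeff_zero_eq_constantCoeff_apply, coeff_derivative]; simp
    simp [this, mul_comm]
  · rw [hu]; linear_combination hr

/-- Leading coefficients add because `f` has linear coefficient `1`; for `m = 0` it would be `1 +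
c`. -/
theorem IsTangent.mul {m : ℕ} {c d : ℂ} {f g : FormalDiff} (hm : m ≠ 0) (hf : IsTangent m c f)
    (hg : IsTangent m d g) : IsTangent m (c + d) (f * g) := by
  have h1 : coeff 1 f.series = 1 := hf.multiplier_eq hm
  obtain ⟨s, hs, hs'⟩ := hg.exists_subst_eq f.series
  obtain ⟨u, rfl, hu⟩ := hf
  refine ⟨u + s, by rw [map_add, hs, h1, one_mul], ?_⟩
  rw [mul_series, hs']
  linear_combination hu

/-- With `λ` the multiplier of `g`, postcomposing with `g` multiplies the leading coefficient by
`λ`, and substituting `g⁻¹` multiplies it by `λ⁻¹ ^ (m + 1)`. -/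
theorem IsTangent.conj {m : ℕ} {c : ℂ} {f : FormalDiff} (hf : IsTangent m c f) (g : FormalDiff) :
    IsTangent m ((multiplier g)⁻¹ ^ m * c) (g * f * g⁻¹) := by
  obtain ⟨s, hs, hs'⟩ := hf.exists_subst_eq g.series
  obtain ⟨v, hv, hv'⟩ := exists_eq_X_mul g⁻¹
  have hinv : multiplier g⁻¹ = (multiplier g)⁻¹ :=
    eq_inv_of_mul_eq_one_left (by rw [← map_mul, inv_mul_cancel, map_one])
  have hg : subst g⁻¹.series g.series = X := by
    rw [← mul_series, mul_inv_cancel, one_series]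
  refine ⟨v ^ (m + 1) * subst g⁻¹.series s, ?_, ?_⟩
  · rw [map_mul, map_pow, hv', constantCoeff_subst_eq g⁻¹.constantCoeff_eq, hs, hinv]
    change _ * (multiplier g * c) = _
    rw [pow_succ, ← mul_assoc, inv_mul_cancel_right₀ (multiplier_ne_zero g)]
  · rw [mul_series, mul_series, hs', subst_add g⁻¹.hasSubst, subst_mul g⁻¹.hasSubst,
      subst_pow g⁻¹.hasSubst, subst_X g⁻¹.hasSubst, hg]
    nth_rw 1 [hv]
    ring

/-- The commutator of two series of order `k` has order greater than `2 k`. -/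
theorem IsTangent.lt_of_mul_eq_mul {k m : ℕ} {α β γ : ℂ} {f h c : FormalDiff}
    (hf : IsTangent k α f) (hh : IsTangent k β h) (hc : IsTangent m γ c) (hγ : γ ≠ 0)
    (e : f * h = c * (h * f)) : 2 * k < m := by
  obtain ⟨u, -, hu⟩ := hf
  obtain ⟨v, -, hv⟩ := hh
  obtain ⟨r, hr⟩ := X_pow_dvd_subst_X_add_sub (Dvd.intro u rfl : X ^ (k + 1) ∣ _) h.series
  obtain ⟨s, hs⟩ := X_pow_dvd_subst_X_add_sub (Dvd.intro v rfl : X ^ (k + 1) ∣ _) f.series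
  rw [← hu] at hr
  rw [← hv] at hs
  have hdvd : X ^ (2 * k + 2) ∣ (f * h).series - (h * f).series := by
    rw [mul_series, mul_series]
    -- The terms `(k + 1) X ^ (2 * k + 1) u v` of the two composites cancel, which gains the extra
    -- order.
    refine ⟨s - r + v * derivative ℂ u - u * derivative ℂ v, ?_⟩
    have du : derivative ℂ f.series = 1 + (((k : PowerSeries ℂ) + 1) * X ^ k * u + X ^ (k + 1) * derivative ℂ u) := by
      rw [hu]; simp [Derivation.leibniz, Derivation.leibniz_pow]; ring
    have dv : derivative ℂ h.series = 1 + (((k : PowerSeries ℂ) + 1) * X ^ k * v + X ^ (k + 1) * derivative ℂ v) := by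
      rw [hv]; simp [Derivation.leibniz, Derivation.leibniz_pow]; ring
    rw [du] at hs
    rw [dv] at hr
    linear_combination hs - hr + hu - hv
  by_contra! hm
  obtain ⟨w, hw, hw'⟩ := exists_eq_X_mul (h * f)
  obtain ⟨t, rfl, ht⟩ := hc
  have hs' := (h * f).hasSubst
  have hc' : (f * h).series - (h * f).series =
      X ^ (m + 1) * (w ^ (m + 1) * subst (h * f).series t) := by
    rw [e, mul_series c, ht, subst_add hs', subst_X hs', subst_mul hs', subst_pow hs', subst_X hs']
    nth_rw 2 [hw]
    ring
  rw [hc'] at hdvd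
  have h0 := X_pow_dvd_iff.mp hdvd (m + 1) (by omega)
  rw [coeff_X_pow_mul', if_pos le_rfl, Nat.sub_self, coeff_zero_eq_constantCoeff_apply, map_mul,
    map_pow, hw', constantCoeff_subst_eq (h * f).constantCoeff_eq] at h0
  exact mul_ne_zero (pow_ne_zero _ (multiplier_ne_zero _)) hγ h0

/-- If `g ^ 2 * f * (g ^ 2)⁻¹ = f ^ 2`, then `f` commutes with `g * f * g⁻¹`. -/
theorem mul_conj_eq_conj_mul {f g : FormalDiff} (e : g ^ 2 * f * (g ^ 2)⁻¹ = f ^ 2) :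
    f * (g * f * g⁻¹) = g * f * g⁻¹ * f := by
  by_cases hf1 : f = 1
  · simp [hf1]
  have hmf : multiplier f = 1 := by
    have h := congrArg multiplier e
    have h0 := multiplier_ne_zero f
    rw [map_mul, map_mul, mul_right_comm, ← map_mul, mul_inv_cancel, map_one, one_mul, map_pow,
      pow_two] at h
    exact (mul_right_cancel₀ h0 ((one_mul _).trans h)).symm
  obtain ⟨k, α, hk, hα, hf⟩ := exists_isTangent hmf hf1
  set h := g * f * g⁻¹ with hh_def
  have hh : IsTangent k _ h := hf.conj g
  have eh : g ^ 2 * h * (g ^ 2)⁻¹ = h ^ 2 := by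
    calc g ^ 2 * h * (g ^ 2)⁻¹ = g * (g ^ 2 * f * (g ^ 2)⁻¹) * g⁻¹ := by rw [hh_def]; group
      _ = h ^ 2 := by rw [e, hh_def, pow_two, pow_two]; group
  set ν := (multiplier (g ^ 2))⁻¹ with hν
  have hνk : ν ^ k = 2 := by
    have h1 : IsTangent k (ν ^ k * α) (f ^ 2) := e ▸ hf.conj (g ^ 2)
    have h2 : IsTangent k (α + α) (f ^ 2) := pow_two f ▸ hf.mul hk hf
    have h3 := h1.unique h2
    rw [← two_mul] at h3
    exact mul_right_cancel₀ hα h3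
  by_contra hne
  set c := f * h * (h * f)⁻¹ with hc_def
  have hcm : f * h = c * (h * f) := by rw [hc_def]; group
  have hc1 : c ≠ 1 := fun h1 => hne (by rw [hcm, h1, one_mul])
  have hmc : multiplier c = 1 := by
    rw [hc_def, map_mul, map_mul, mul_comm (multiplier f), ← map_mul, ← map_mul, mul_inv_cancel,
      map_one]
  obtain ⟨m, γ, hm, hγ, hc⟩ := exists_isTangent hmc hc1
  have hlt : 2 * k < m := hf.lt_of_mul_eq_mul hh hc hγ hcm
  have hconj (p : FormalDiff) (hp : multiplier p = 1) {d : ℂ} {q : FormalDiff}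
      (hq : IsTangent m d q) : IsTangent m d (p * q * p⁻¹) := by
    simpa [hp] using hq.conj p
  have hmh : multiplier h = 1 := hh.multiplier_eq hk
  have he := hc.mul hm (hconj h hmh hc)
  have h4 := (hconj f hmf he).mul hm he
  -- This combines `[f, h²] = c · h c h⁻¹` with `[f², y] = f [f, y] f⁻¹ · [f, y]` for `y = h²`.
  have key : f * (c * (h * c * h⁻¹)) * f⁻¹ * (c * (h * c * h⁻¹)) =
      g ^ 2 * c * (g ^ 2)⁻¹ := by
    have h1 : g ^ 2 * c * (g ^ 2)⁻¹ = f ^ 2 * h ^ 2 * (h ^ 2 * f ^ 2)⁻¹ := by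
      rw [← e, ← eh, hc_def]; group
    rw [h1, hc_def, pow_two, pow_two]; group
  rw [key] at h4
  have h5 := (hc.conj (g ^ 2)).unique h4
  have hνm : ν ^ m = 4 := mul_right_cancel₀ hγ (by rw [h5]; ring)
  have hν2 : ν ^ (2 * k) = 4 := by rw [mul_comm, pow_mul, hνk]; norm_num
  obtain ⟨j, rfl⟩ := Nat.exists_eq_add_of_lt hlt
  have hνj : ν ^ (j + 1) = 1 := by
    rw [add_assoc, pow_add, hν2] at hνm
    exact mul_left_cancel₀ (by norm_num : (4 : ℂ) ≠ 0) (hνm.trans (mul_one _).symm)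
  have hn : ‖ν‖ = 1 := Complex.norm_eq_one_of_pow_eq_one hνj (Nat.succ_ne_zero j)
  have := congrArg norm hνk
  rw [norm_pow, hn, one_pow] at this
  norm_num at this

end FormalDiff

/-! ### Asymptotic expansions and Taylor series -/

open Asymptotics in
theorem Polynomial.X_pow_dvd_of_isBigO {P : Polynomial ℂ} {n : ℕ}
    (h : (fun z => P.eval z) =O[𝓝 0] fun z : ℂ => z ^ n) : Polynomial.X ^ n ∣ P := by
  induction n with
  | zero => simp
  | succ n ih =>
    have hle : (fun z : ℂ => z ^ (n + 1)) =O[𝓝 0] fun z : ℂ => z ^ n :=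
      (isLittleO_pow_pow (Nat.lt_succ_self n)).isBigO
    obtain ⟨Q, rfl⟩ := ih (h.trans hle)
    have hQ : (fun z => Q.eval z) =O[𝓝[≠] 0] fun z : ℂ => z := by
      have h1 := ((isBigO_refl (fun z : ℂ => (z ^ n)⁻¹) (𝓝[≠] 0)).mul
        (h.mono nhdsWithin_le_nhds))
      refine h1.congr' ?_ ?_ <;>
      · filter_upwards [self_mem_nhdsWithin] with z hz
        have : z ≠ 0 := hz
        simp [pow_succ, this]
    have h0 : Tendsto (fun z => Q.eval z) (𝓝[≠] 0) (𝓝 0) :=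
      hQ.trans_tendsto (tendsto_id.mono_left nhdsWithin_le_nhds)
    have h1 : Tendsto (fun z => Q.eval z) (𝓝[≠] 0) (𝓝 (Q.eval 0)) :=
      Q.continuous.continuousAt.tendsto.mono_left nhdsWithin_le_nhds
    obtain ⟨R, rfl⟩ := Polynomial.X_dvd_iff.mpr
      ((Polynomial.coeff_zero_eq_eval_zero Q).trans (tendsto_nhds_unique h1 h0))
    exact ⟨R, by ring⟩

open Asymptotics in
/-- `S` is an asymptotic expansion of `f` at `0`. -/
def HasAsymptoticSeries (f : ℂ → ℂ) (S : PowerSeries ℂ) : Prop :=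
  ∀ n, ∃ P : Polynomial ℂ, PowerSeries.X ^ n ∣ (P : PowerSeries ℂ) - S ∧
    (fun z => f z - P.eval z) =O[𝓝 0] fun z : ℂ => z ^ n

namespace HasAsymptoticSeries
open PowerSeries Asymptotics

theorem unique {f : ℂ → ℂ} {S T : PowerSeries ℂ} (hS : HasAsymptoticSeries f S)
    (hT : HasAsymptoticSeries f T) : S = T := by
  ext n
  obtain ⟨P, hP, hP'⟩ := hS (n + 1)
  obtain ⟨Q, hQ, hQ'⟩ := hT (n + 1)
  obtain ⟨R, hR⟩ : Polynomial.X ^ (n + 1) ∣ P - Q := by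
    refine Polynomial.X_pow_dvd_of_isBigO ((hQ'.sub hP').congr_left fun z => ?_)
    rw [Polynomial.eval_sub]; ring
  have h1 : (X : PowerSeries ℂ) ^ (n + 1) ∣ (P : PowerSeries ℂ) - Q :=
    ⟨R, by rw [← Polynomial.coe_sub, hR]; simp⟩
  have h2 : X ^ (n + 1) ∣ S - T := by
    have := dvd_add (dvd_sub h1 hP) hQ
    rwa [show (P : PowerSeries ℂ) - Q - (P - S) + (Q - T) = S - T by ring] at this
  have h3 := X_pow_dvd_iff.mp h2 n n.lt_succ_self
  rwa [map_sub, sub_eq_zero] at h3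

/-- If `P` and `Q` approximate `f` and `g` to order `n`, then `P ∘ Q` approximates `f ∘ g`, since
polynomials are Lipschitz near `0`. -/
theorem comp {f g : ℂ → ℂ} {S T : PowerSeries ℂ} (hf : HasAsymptoticSeries f S)
    (hg : HasAsymptoticSeries g T) (hT : constantCoeff T = 0) (hg0 : Tendsto g (𝓝 0) (𝓝 0))
    (hgz : g =O[𝓝 0] fun z : ℂ => z) :
    HasAsymptoticSeries (f ∘ g) (subst T S) := by
  intro n
  have hT' : HasSubst T := HasSubst.of_constantCoeff_zero' hT
  obtain ⟨P, ⟨r, hr⟩, hP'⟩ := hf n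
  obtain ⟨Q, hQ, hQ'⟩ := hg n
  refine ⟨P.comp Q, ?_, ?_⟩
  · have h1 : ((P.comp Q : Polynomial ℂ) : PowerSeries ℂ) = 
        Polynomial.aeval (Q : PowerSeries ℂ) P := by
      change Polynomial.coeToPowerSeries.ringHom (P.eval₂ Polynomial.C Q) = _
      rw [Polynomial.hom_eval₂, Polynomial.aeval_def]
      congr 1
      ext a
      simp
    have h2 : subst T S = Polynomial.aeval T P - T ^ n * subst T r := by
      rw [show S = (P : PowerSeries ℂ) - X ^ n * r by rw [← hr]; ring, subst_sub hT',
        subst_mul hT', subst_pow hT', subst_X hT', subst_coe hT']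
    rw [h1, h2]
    have h3 : (Q : PowerSeries ℂ) - T ∣ Polynomial.aeval (Q : PowerSeries ℂ) P -
        Polynomial.aeval T P := by
      rw [← Polynomial.eval_map_algebraMap, ← Polynomial.eval_map_algebraMap]
      exact Polynomial.sub_dvd_eval_sub _ _ _
    have h4 : X ^ n ∣ T ^ n * subst T r :=
      Dvd.dvd.mul_right (pow_dvd_pow_of_dvd (X_dvd_iff.mpr hT) n) _
    rw [← sub_add]
    exact dvd_add (hQ.trans h3) h4
  · have h1 : (fun z => f (g z) - P.eval (g z)) =O[𝓝 0] fun z : ℂ => z ^ n :=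
      (hP'.comp_tendsto hg0).trans (hgz.pow n)
    have h2 : (fun z => P.eval (g z) - P.eval (Q.eval z)) =O[𝓝 0] fun z : ℂ => z ^ n := by
      -- For `n = 0` nothing forces `Q` to vanish at `0`, but boundedness suffices.
      rcases n with _ | n
      · have hPg := (P.continuous.tendsto 0).comp hg0
        have hPQ := (P.comp Q).continuous.tendsto 0
        simp only [Polynomial.eval_comp] at hPQ
        simpa using (hPg.sub hPQ).isBigO_one ℂ
      · have hQ0 : Q.eval 0 = 0 := by
          have := X_pow_dvd_iff.mp hQ 0 n.succ_pos
          rw [map_sub, Polynomial.coeff_coe, coeff_zero_eq_constantCoeff_apply, hT, sub_zero] at this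
          rwa [← Polynomial.coeff_zero_eq_eval_zero]
        have hQt : Tendsto (fun z => Q.eval z) (𝓝 0) (𝓝 0) := by
          simpa [hQ0] using Q.continuous.tendsto 0
        exact ((P.hasStrictDerivAt 0).hasStrictFDerivAt.isBigO_sub.comp_tendsto
          (hg0.prodMk_nhds hQt)).trans hQ'
    refine (h1.add h2).congr_left fun z => ?_
    simp

end HasAsymptoticSeries

/-- The Taylor series at `0`. -/
def taylorSeries (f : ℂ → ℂ) : PowerSeries ℂ :=
  PowerSeries.mk fun n => iteratedDeriv n f 0 / n.factorial

theorem AnalyticAt.hasAsymptoticSeries {f : ℂ → ℂ} (hf : AnalyticAt ℂ f 0) :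
    HasAsymptoticSeries f (taylorSeries f) := by
  intro n
  refine ⟨_, PowerSeries.X_pow_dvd_trunc_sub _ n, ?_⟩
  have h := hf.hasFPowerSeriesAt.isBigO_sub_partialSum_pow n
  simp only [← norm_pow, Asymptotics.isBigO_norm_right] at h
  refine h.congr_left fun z => ?_
  rw [zero_add, Polynomial.eval, PowerSeries.eval₂_trunc_eq_sum_range]
  simp [FormalMultilinearSeries.partialSum, taylorSeries, mul_comm]

theorem AnalyticAt.eventuallyEq_of_taylorSeries_eq {f g : ℂ → ℂ} (hf : AnalyticAt ℂ f 0)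
    (hg : AnalyticAt ℂ g 0) (h : taylorSeries f = taylorSeries g) : f =ᶠ[𝓝 0] g := by
  have hf' := hf.hasFPowerSeriesAt
  have hg' := hg.hasFPowerSeriesAt
  have h' : (fun n => iteratedDeriv n f 0 / (n.factorial : ℂ)) =
      fun n => iteratedDeriv n g 0 / (n.factorial : ℂ) := by
    ext n
    simpa [taylorSeries] using congrArg (PowerSeries.coeff n) h
  rw [h'] at hf'
  have h0 := (hf'.sub hg')
  rw [sub_self] at h0
  filter_upwards [h0.eventually_eq_zero] with z hz
  exact sub_eq_zero.mp hz

/-! ### Embedding germs into formal diffeomorphisms -/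

namespace DiffRep

theorem hasAsymptoticSeries (f : DiffRep) : HasAsymptoticSeries f.toFun (taylorSeries f.toFun) :=
  f.analyticAt.hasAsymptoticSeries

/-- The Taylor series of a representative as a formal diffeomorphism. -/
def toFormalDiff (f : DiffRep) : FormalDiff where
  series := taylorSeries f.toFun
  constantCoeff_eq := by
    rw [← PowerSeries.coeff_zero_eq_constantCoeff_apply]; simp [taylorSeries, f.map_zero]
  coeff_one_ne := by simpa [taylorSeries] using f.deriv_ne

/-- Both series are asymptotic expansions of the same function, so uniqueness replaces any formula
for higher derivatives of a composite. -/
theorem toFormalDiff_comp (f g : DiffRep) :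
    (comp f g).toFormalDiff = f.toFormalDiff * g.toFormalDiff := by
  refine FormalDiff.ext ((comp f g).hasAsymptoticSeries.unique ?_)
  refine f.hasAsymptoticSeries.comp g.hasAsymptoticSeries g.toFormalDiff.constantCoeff_eq
    g.tendsto ?_
  simpa [g.map_zero] using g.analyticAt.differentiableAt.isBigO_sub

theorem toFormalDiff_eq_iff {f g : DiffRep} : f.toFormalDiff = g.toFormalDiff ↔ f ≈ g := by
  refine ⟨fun h => f.analyticAt.eventuallyEq_of_taylorSeries_eq g.analyticAt
    (congrArg FormalDiff.series h), fun h => FormalDiff.ext ?_⟩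
  ext n
  have h' : f.toFun =ᶠ[𝓝 0] g.toFun := h
  simp [toFormalDiff, taylorSeries, h'.iteratedDeriv_eq n]

end DiffRep

/-- The Taylor series of a germ, as a group homomorphism. -/
def HoloDiff.toFormalDiff : HoloDiff →* FormalDiff :=
  MonoidHom.mk' (Quotient.lift DiffRep.toFormalDiff fun _ _ => DiffRep.toFormalDiff_eq_iff.mpr)
    fun φ ψ => by
      induction φ using Quotient.inductionOn with
      | h f => induction ψ using Quotient.inductionOn with
        | h g => exact DiffRep.toFormalDiff_comp f g

theorem HoloDiff.toFormalDiff_injective : Function.Injective HoloDiff.toFormalDiff := by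
  intro φ ψ h
  induction φ using Quotient.inductionOn with
  | h f => induction ψ using Quotient.inductionOn with
    | h g => exact Quotient.sound (DiffRep.toFormalDiff_eq_iff.mp h)

/-! ### Noncommutation in the abstract group, and conclusion -/

namespace DrutuSapirGroup

open Equiv in
/-- A finite quotient in which `a` and `b a b⁻¹` do not commute. -/
theorem not_commute_conj :
    (PresentedGroup.of 0 : DrutuSapirGroup) *
      (PresentedGroup.of 1 * PresentedGroup.of 0 * (PresentedGroup.of 1)⁻¹) ≠
      PresentedGroup.of 1 * PresentedGroup.of 0 * (PresentedGroup.of 1)⁻¹ *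
        PresentedGroup.of 0 := by
  -- Here `A = (0 1 2)` and `B = (0 3 1 4)`: `B² = (0 1)(3 4)` inverts `A`, and `A⁻¹ = A²`, while `B
  -- A B⁻¹ = (2 3 4)` shares only the point `2` with the support of `A`.
  let A : Perm (Fin 5) := swap 0 1 * swap 1 2
  let B : Perm (Fin 5) := swap 0 3 * swap 3 1 * swap 1 4
  have h : ∀ r ∈ ({drutuSapirRelator} : Set (FreeGroup (Fin 2))),
      FreeGroup.lift ![A, B] r = 1 := by
    rintro _ rfl
    simp only [drutuSapirRelator, map_mul, map_inv, map_pow, FreeGroup.lift_apply_of]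
    decide
  intro e
  have e' := congrArg (PresentedGroup.toGroup h) e
  simp only [map_mul, map_inv, PresentedGroup.toGroup.of] at e'
  revert e'
  decide

theorem relation : (PresentedGroup.of 1 : DrutuSapirGroup) ^ 2 * PresentedGroup.of 0 *
    (PresentedGroup.of 1 ^ 2)⁻¹ = PresentedGroup.of 0 ^ 2 :=
  mul_inv_eq_one.mp (PresentedGroup.one_of_mem rfl)

end DrutuSapirGroup
theorem FormalDiff.not_injective (φ : DrutuSapirGroup →* FormalDiff) :
    ¬ Function.Injective φ := by
  intro hφ
  refine DrutuSapirGroup.not_commute_conj (hφ ?_)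
  have h := congrArg φ DrutuSapirGroup.relation
  simp only [map_mul, map_inv, map_pow] at h ⊢
  exact FormalDiff.mul_conj_eq_conj_mul h

theorem mainTheorem9 :
    (∀ φ : DrutuSapirGroup →* FormalDiff, ¬ Function.Injective φ) ∧
      (∀ φ : DrutuSapirGroup →* HoloDiff, ¬ Function.Injective φ) :=
  ⟨FormalDiff.not_injective, fun φ hφ =>
    FormalDiff.not_injective (HoloDiff.toFormalDiff.comp φ)
      (HoloDiff.toFormalDiff_injective.comp hφ)⟩

end
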